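/- Let $K$ be a field and let $E$ and $F$ be finite directed graphs (finitely many vertices and edges) with no sinks (every vertex emits at least one edge). Write $L_K(E)$ for the Leavitt path algebra of $E$: the unital $K$-algebra generated by the vertices $v\in E^0$, the edges $e\in E^1$ and the ghost edges $e^*$ $(e\in E^1)$, subject to $vw=\delta_{v,w}v$, $s(e)e=e=e\,r(e)$, $r(e)e^*=e^*=e^*s(e)$, $e^*f=\delta_{e,f}\,r(e)$, $v=\sum_{s(e)=v}ee^*$ for every vertex $v$ that emits an edge, and $\sum_{v\in E^0}v=1$; it is $\mathbb Z$-graded with vertices in degree $0$, edges in degree $1$ and ghost edges in degree $-1$. For a unital $\mathbb Z$-graded ring $A$, let $Gr\text{-}A$ be the category of graded right $A$-modules with degree-preserving homomorphisms, and for $n\in\mathbb Z$ let $\mathcal T_n: Gr\text{-}A\to Gr\text{-}A$ be the suspension functor, $M\mapsto M(n)$ with $M(n)_m=M_{n+m}$, the identity on morphisms. A functor $\phi: Gr\text{-}A\to Gr\text{-}B$ is *graded* if $\phi\circ\mathcal T_n=\mathcal T_n\circ\phi$ for all $n$; a graded functor $\phi$ is a *graded equivalence* if there is a graded functor $\psi: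 Gr\text{-}B\to Gr\text{-}A$ such that $\psi\circ\phi$ and $\phi\circ\psi$ are naturally isomorphic to the identity functors. The rings $A$ and $B$ are *graded equivalent* if there is a graded equivalence $Gr\text{-}A\to Gr\text{-}B$. They are *homogeneously graded equivalent* if there are a graded equivalence $\psi: Gr\text{-}A\to Gr\text{-}B$ and an equivalence of categories $\eta: Mod\text{-}A_0\to Mod\text{-}B_0$ (right modules over the degree-zero subrings) such that for every right $A_0$-module $M$ there is an isomorphism $\psi(M\otimes_{A_0}A)\cong\eta(M)\otimes_{B_0}B$ in $Gr\text{-}B$, where $(M\otimes_{A_0}A)_n=M\otimes_{A_0}A_n$, and similarly for $B$. Then $L_K(E)$ is graded equivalent to $L_K(F)$ if and only if $L_K(E)$ is homogeneously graded equivalent to $L_K(F)$. -/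

import Mathlib

open CategoryTheory MulOpposite
open scoped TensorProduct DirectSum

universe u v w z

/-- A family of additive projections onto the members of a spanning family exhibits it as an
internal direct sum. -/
theorem isInternal_of_proj {ι M S : Type*} [DecidableEq ι] [AddCommGroup M] [SetLike S M]
    [AddSubgroupClass S M] (D : ι → S) (p : ι → M →+ M)
    (hp : ∀ i, ∀ x ∈ D i, p i x = x) (hp' : ∀ i j, i ≠ j → ∀ x ∈ D i, p j x = 0)
    (hspan : ∀ x : M, x ∈ AddSubmonoid.closure {y : M | ∃ i, y ∈ D i}) :
    DirectSum.IsInternal D := by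
  have key : ∀ (y : ⨁ i, D i) (j : ι),
      p j (DirectSum.coeAddMonoidHom D y) = (y j : M) := by
    intro y j
    induction y using DirectSum.induction_on with
    | zero => simp
    | of i x =>
      rw [DirectSum.coeAddMonoidHom_of]
      by_cases h : i = j
      · subst h
        rw [DirectSum.of_eq_same, hp _ _ x.2]
      · rw [DirectSum.of_eq_of_ne _ _ _ (Ne.symm h), hp' i j h _ x.2]
        simp
    | add a b ha hb => rw [map_add, map_add, ha, hb]; simp
  constructor
  · rw [injective_iff_map_eq_zero]
    intro y hy
    ext j
    rw [← key y j, hy]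
    simp
  · intro x
    induction hspan x using AddSubmonoid.closure_induction with
    | mem y hy =>
      obtain ⟨i, hi⟩ := hy
      exact ⟨DirectSum.of (fun i => D i) i ⟨y, hi⟩, DirectSum.coeAddMonoidHom_of D i ⟨y, hi⟩⟩
    | zero => exact ⟨0, map_zero _⟩
    | add a b _ _ ha hb =>
      obtain ⟨a', rfl⟩ := ha
      obtain ⟨b', rfl⟩ := hb
      exact ⟨a' + b', map_add _ _ _⟩

/-- Reindexing an internal direct sum along a bijection. -/
theorem isInternal_reindex {ι κ M S : Type*} [DecidableEq ι] [DecidableEq κ] [AddCommGroup M]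
    [SetLike S M] [AddSubgroupClass S M] (D : ι → S) (hD : DirectSum.IsInternal D) (e : κ ≃ ι) :
    DirectSum.IsInternal (fun k => D (e k)) := by
  let := hD.chooseDecomposition
  refine isInternal_of_proj _
    (fun k => AddMonoidHom.mk' (fun x => (DirectSum.decompose D x (e k) : M)) ?_) ?_ ?_ ?_
  · intro a b
    simp
  · intro k x hx
    exact DirectSum.decompose_of_mem_same D hx
  · intro i j hij x hx
    exact DirectSum.decompose_of_mem_ne D hx (fun h => hij (e.injective h))
  · intro x
    classical
    rw [← DirectSum.sum_support_decompose D x]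
    refine AddSubmonoid.sum_mem _ fun i _ => AddSubmonoid.subset_closure ⟨e.symm i, ?_⟩
    rw [e.apply_symm_apply]
    exact (DirectSum.decompose D x i).2

/-! ### Graded right modules -/

section Graded

variable {Γ : Type v} [AddCommGroup Γ] [DecidableEq Γ]
variable {A : Type u} [Ring A] {σ : Type*} [SetLike σ A] [AddSubgroupClass σ A]

/-- A `Γ`-graded right module over the `Γ`-graded ring `A = ⨁ γ, 𝒜 γ`.  Right `A`-modules are
modules over `Aᵐᵒᵖ`, with `m · a = op a • m`. -/
structure GrMod (𝒜 : Γ → σ) [GradedRing 𝒜] where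
  carrier : Type w
  [addCommGroup : AddCommGroup carrier]
  [module : Module Aᵐᵒᵖ carrier]
  deg : Γ → AddSubgroup carrier
  isInternal : DirectSum.IsInternal deg
  smul_mem : ∀ ⦃γ δ : Γ⦄ ⦃m : carrier⦄ ⦃a : A⦄,
    m ∈ deg γ → a ∈ 𝒜 δ → op a • m ∈ deg (γ + δ)

namespace GrMod

attribute [instance] addCommGroup module

variable {𝒜 : Γ → σ} [GradedRing 𝒜]

/-- Graded homomorphisms: `A`-linear maps `f` with `f (M_γ) ⊆ N_γ` for all `γ`. -/
@[ext]
structure Hom (M N : GrMod.{u, v, w} 𝒜) where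
  toLinearMap : M.carrier →ₗ[Aᵐᵒᵖ] N.carrier
  map_mem : ∀ ⦃γ : Γ⦄ ⦃m : M.carrier⦄, m ∈ M.deg γ → toLinearMap m ∈ N.deg γ

/-- The category `Gr-A` of graded right `A`-modules. -/
instance : Category (GrMod.{u, v, w} 𝒜) where
  Hom M N := Hom M N
  id M := ⟨LinearMap.id, fun _ _ h => h⟩
  comp f g := ⟨g.toLinearMap.comp f.toLinearMap, fun _ _ h => g.map_mem (f.map_mem h)⟩

variable (𝒜) in
/-- The suspension functor `𝒯_α`, with `M(α)_γ = M_{α + γ}`, the identity on morphisms. -/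
def suspension (α : Γ) : GrMod.{u, v, w} 𝒜 ⥤ GrMod.{u, v, w} 𝒜 where
  obj M :=
    { carrier := M.carrier
      deg := fun γ => M.deg (α + γ)
      isInternal := isInternal_reindex M.deg M.isInternal (Equiv.addLeft α)
      smul_mem := fun γ δ m a hm ha => by
        rw [← add_assoc]
        exact M.smul_mem hm ha }
  map f := ⟨f.toLinearMap, fun _ _ h => f.map_mem h⟩

end GrMod

/-! ### The graded module `M ⊗_{A₀} A` -/

namespace InducedGr

variable (𝒜 : Γ → σ) [GradedRing 𝒜]
variable (M : Type w) [AddCommGroup M] [Module (𝒜 0)ᵐᵒᵖ M]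

/-- The `A`-submodule of `A ⊗_ℤ M` generated by the elements `(r a) ⊗ m - a ⊗ (m r)` with
`r ∈ A₀`.  (This generating set is stable under the right action of `A`, so the `A`-submodule and
the additive subgroup that it generates coincide.) -/
def relations : Submodule Aᵐᵒᵖ (A ⊗[ℤ] M) :=
  Submodule.span Aᵐᵒᵖ
    {x | ∃ (a : A) (r : 𝒜 0) (m : M), x = ((r : A) * a) ⊗ₜ[ℤ] m - a ⊗ₜ[ℤ] (op r • m)}

/-- The tensor product `M ⊗_{A₀} A` of the right `A₀`-module `M` with the `A₀`-`A`-bimodule `A`,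
as a right `A`-module.  It is written as a quotient of `A ⊗_ℤ M`, with the factors in this order
because `A` then acts, by right multiplication, on the first factor. -/
abbrev Carrier : Type (max u w) := (A ⊗[ℤ] M) ⧸ relations 𝒜 M

/-- The element `m ⊗ a` of `M ⊗_{A₀} A`. -/
def tmul (m : M) (a : A) : Carrier 𝒜 M := (relations 𝒜 M).mkQ (a ⊗ₜ[ℤ] m)

/-- `(M ⊗_{A₀} A)_γ = M ⊗_{A₀} A_γ`. -/
def deg (γ : Γ) : AddSubgroup (Carrier 𝒜 M) :=
  AddSubgroup.closure {x | ∃ (m : M) (a : A), a ∈ 𝒜 γ ∧ x = tmul 𝒜 M m a}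

theorem smul_tmul (m : M) (a b : A) : op b • tmul 𝒜 M m a = tmul 𝒜 M m (a * b) := rfl

theorem tmul_induction {P : Carrier 𝒜 M → Prop} (x : Carrier 𝒜 M) (h0 : P 0)
    (ht : ∀ m a, P (tmul 𝒜 M m a)) (ha : ∀ x y, P x → P y → P (x + y)) : P x := by
  obtain ⟨y, rfl⟩ := (relations 𝒜 M).mkQ_surjective x
  induction y using TensorProduct.induction_on with
  | zero => rw [map_zero]; exact h0
  | tmul a m => exact ht m a
  | add a b ha' hb' => rw [map_add]; exact ha _ _ ha' hb'

/-- The projection of `A ⊗_ℤ M` onto `A_γ ⊗ M`. -/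
noncomputable def projAux (γ : Γ) : (A ⊗[ℤ] M) →+ (A ⊗[ℤ] M) :=
  (LinearMap.rTensor M (GradedRing.proj 𝒜 γ).toIntLinearMap).toAddMonoidHom

theorem projAux_tmul (γ : Γ) (a : A) (m : M) :
    projAux 𝒜 M γ (a ⊗ₜ m) = (GradedRing.proj 𝒜 γ a) ⊗ₜ m := rfl

theorem proj_zero_mul (γ : Γ) (r : 𝒜 0) (a : A) :
    GradedRing.proj 𝒜 γ ((r : A) * a) = (r : A) * GradedRing.proj 𝒜 γ a := by
  have := DirectSum.coe_decompose_mul_add_of_left_mem 𝒜 (i := 0) (j := γ) (a := (r : A)) (b := a)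
    r.2
  rwa [zero_add] at this

theorem projAux_mem (γ : Γ) (x : A ⊗[ℤ] M) (hx : x ∈ relations 𝒜 M) :
    projAux 𝒜 M γ x ∈ relations 𝒜 M := by
  induction hx using Submodule.closure_induction with
  | zero => rw [map_zero]; exact Submodule.zero_mem _
  | add x y _ _ hx hy => rw [map_add]; exact Submodule.add_mem _ hx hy
  | smul_mem b x hx =>
    obtain ⟨a, r, m, rfl⟩ := hx
    refine Submodule.subset_span ⟨GradedRing.proj 𝒜 γ (a * b.unop), r, m, ?_⟩
    rw [smul_sub, TensorProduct.smul_tmul', TensorProduct.smul_tmul', map_sub, projAux_tmul,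
      projAux_tmul, ← proj_zero_mul, ← mul_assoc]
    rfl

/-- The projection of `M ⊗_{A₀} A` onto its component of degree `γ`. -/
noncomputable def proj (γ : Γ) : Carrier 𝒜 M →+ Carrier 𝒜 M :=
  QuotientAddGroup.map (relations 𝒜 M).toAddSubgroup (relations 𝒜 M).toAddSubgroup
    (projAux 𝒜 M γ) (projAux_mem 𝒜 M γ)

theorem proj_tmul (γ : Γ) (m : M) (a : A) :
    proj 𝒜 M γ (tmul 𝒜 M m a) = tmul 𝒜 M m (GradedRing.proj 𝒜 γ a) := rfl

theorem tmul_zero (m : M) : tmul 𝒜 M m 0 = 0 := by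
  rw [tmul, TensorProduct.zero_tmul, map_zero]

theorem isInternal : DirectSum.IsInternal (deg 𝒜 M) := by
  refine isInternal_of_proj _ (proj 𝒜 M) ?_ ?_ ?_
  · intro γ x hx
    induction hx using AddSubgroup.closure_induction with
    | mem x hx =>
      obtain ⟨m, a, ha, rfl⟩ := hx
      rw [proj_tmul, GradedRing.proj_apply, DirectSum.decompose_of_mem_same 𝒜 ha]
    | zero => exact map_zero _
    | add x y _ _ hx hy => rw [map_add, hx, hy]
    | neg x _ hx => rw [map_neg, hx]
  · intro γ δ h x hx
    induction hx using AddSubgroup.closure_induction with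
    | mem x hx =>
      obtain ⟨m, a, ha, rfl⟩ := hx
      rw [proj_tmul, GradedRing.proj_apply, DirectSum.decompose_of_mem_ne 𝒜 ha h, tmul_zero]
    | zero => exact map_zero _
    | add x y _ _ hx hy => rw [map_add, hx, hy, add_zero]
    | neg x _ hx => rw [map_neg, hx, neg_zero]
  · intro x
    induction x using tmul_induction with
    | h0 => exact AddSubmonoid.zero_mem _
    | ha x y hx hy => exact AddSubmonoid.add_mem _ hx hy
    | ht m a =>
      classical
      rw [← DirectSum.sum_support_decompose 𝒜 a, tmul, TensorProduct.sum_tmul, map_sum]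
      exact AddSubmonoid.sum_mem _ fun i _ => AddSubmonoid.subset_closure
        ⟨i, AddSubgroup.subset_closure ⟨m, _, (DirectSum.decompose 𝒜 a i).2, rfl⟩⟩

theorem smul_mem ⦃γ δ : Γ⦄ ⦃x : Carrier 𝒜 M⦄ ⦃b : A⦄ (hx : x ∈ deg 𝒜 M γ) (hb : b ∈ 𝒜 δ) :
    op b • x ∈ deg 𝒜 M (γ + δ) := by
  induction hx using AddSubgroup.closure_induction with
  | mem x hx =>
    obtain ⟨m, a, ha, rfl⟩ := hx
    rw [smul_tmul]
    exact AddSubgroup.subset_closure ⟨m, _, SetLike.mul_mem_graded ha hb, rfl⟩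
  | zero => rw [smul_zero]; exact AddSubgroup.zero_mem _
  | add x y _ _ hx hy => rw [smul_add]; exact AddSubgroup.add_mem _ hx hy
  | neg x _ hx => rw [smul_neg]; exact AddSubgroup.neg_mem _ hx

end InducedGr

/-- The object `M ⊗_{A₀} A` of `Gr-A`, for a right `A₀`-module `M`. -/
def inducedGr (𝒜 : Γ → σ) [GradedRing 𝒜] (M : ModuleCat.{max u w} (𝒜 0)ᵐᵒᵖ) :
    GrMod.{u, v, max u w} 𝒜 where
  carrier := InducedGr.Carrier 𝒜 M
  deg := InducedGr.deg 𝒜 M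
  isInternal := InducedGr.isInternal 𝒜 M
  smul_mem := InducedGr.smul_mem 𝒜 M

/-! ### Graded equivalence and homogeneously graded equivalence -/

variable {B : Type u} [Ring B] {τ : Type*} [SetLike τ B] [AddSubgroupClass τ B]
variable {𝒜 : Γ → σ} [GradedRing 𝒜] {ℬ : Γ → τ} [GradedRing ℬ]

/-- A functor `φ : Gr-A ⥤ Gr-B` is graded when `φ ∘ 𝒯_α = 𝒯_α ∘ φ` for each `α`. -/
def IsGradedFunctor (φ : GrMod.{u, v, w} 𝒜 ⥤ GrMod.{u, v, w} ℬ) : Prop :=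
  ∀ α : Γ, GrMod.suspension 𝒜 α ⋙ φ = φ ⋙ GrMod.suspension ℬ α

/-- A graded functor is a graded equivalence when it has a graded quasi-inverse. -/
def IsGradedEquivalence (φ : GrMod.{u, v, w} 𝒜 ⥤ GrMod.{u, v, w} ℬ) : Prop :=
  IsGradedFunctor φ ∧ ∃ ψ : GrMod.{u, v, w} ℬ ⥤ GrMod.{u, v, w} 𝒜,
    IsGradedFunctor ψ ∧ Nonempty (φ ⋙ ψ ≅ 𝟭 _) ∧ Nonempty (ψ ⋙ φ ≅ 𝟭 _)

variable (𝒜 ℬ)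

/-- `A` and `B` are graded (Morita) equivalent.  The modules live in an arbitrary universe that
contains the rings. -/
def GradedEquivalent : Prop :=
  ∃ φ : GrMod.{u, v, max u w} 𝒜 ⥤ GrMod.{u, v, max u w} ℬ, IsGradedEquivalence φ

/-- `A` and `B` are homogeneously graded equivalent: there are a graded equivalence
`ψ : Gr-A ⥤ Gr-B` and an equivalence `η : Mod-A₀ ⥤ Mod-B₀` with
`ψ (M ⊗_{A₀} A) ≅ η M ⊗_{B₀} B` in `Gr-B` for each right `A₀`-module `M`. -/
def HomogeneouslyGradedEquivalent : Prop :=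
  ∃ ψ : GrMod.{u, v, max u w} 𝒜 ⥤ GrMod.{u, v, max u w} ℬ, IsGradedEquivalence ψ ∧
    ∃ η : ModuleCat.{max u w} (𝒜 0)ᵐᵒᵖ ⥤ ModuleCat.{max u w} (ℬ 0)ᵐᵒᵖ, η.IsEquivalence ∧
      ∀ M : ModuleCat.{max u w} (𝒜 0)ᵐᵒᵖ,
        Nonempty (ψ.obj (inducedGr.{u, v, w} 𝒜 M) ≅ inducedGr.{u, v, w} ℬ (η.obj M))

end Graded

/-! ### Leavitt path algebras of finite graphs -/

/-- A directed graph `(E⁰, E¹, s, r)`; loops and multiple edges are allowed. -/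
structure DirectedGraph where
  Vertex : Type v
  Edge : Type v
  source : Edge → Vertex
  range : Edge → Vertex

namespace DirectedGraph

/-- No vertex is a sink: every vertex emits an edge. -/
def NoSinks (E : DirectedGraph.{v}) : Prop := ∀ x : E.Vertex, ∃ e : E.Edge, E.source e = x

/-- The generators `x ∈ E⁰`, `e ∈ E¹` and `e*` (`e ∈ E¹`) of the Leavitt path algebra. -/
inductive Gen (E : DirectedGraph.{v}) : Type v
  | vertex (x : E.Vertex) : Gen E
  | edge (e : E.Edge) : Gen E
  | ghost (e : E.Edge) : Gen E

/-- The degrees of the generators: `0` for a vertex, `1` for an edge, `-1` for a ghost edge. -/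
def Gen.degree {E : DirectedGraph.{v}} : Gen E → ℤ
  | .vertex _ => 0
  | .edge _ => 1
  | .ghost _ => -1

variable (K : Type u) [Field K] (E : DirectedGraph.{v}) [Fintype E.Vertex] [Fintype E.Edge]

open Classical in
/-- The defining relations of the Leavitt path algebra of a finite graph.  The last one says that
the sum of the vertices is the identity element. -/
inductive LeavittRel : FreeAlgebra K (Gen E) → FreeAlgebra K (Gen E) → Prop
  | vertex_mul_self (x : E.Vertex) :
      LeavittRel (FreeAlgebra.ι K (.vertex x) * FreeAlgebra.ι K (.vertex x))
        (FreeAlgebra.ι K (.vertex x))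
  | vertex_mul_vertex (x y : E.Vertex) (h : x ≠ y) :
      LeavittRel (FreeAlgebra.ι K (.vertex x) * FreeAlgebra.ι K (.vertex y)) 0
  | source_mul_edge (e : E.Edge) :
      LeavittRel (FreeAlgebra.ι K (.vertex (E.source e)) * FreeAlgebra.ι K (.edge e))
        (FreeAlgebra.ι K (.edge e))
  | edge_mul_range (e : E.Edge) :
      LeavittRel (FreeAlgebra.ι K (.edge e) * FreeAlgebra.ι K (.vertex (E.range e)))
        (FreeAlgebra.ι K (.edge e))
  | range_mul_ghost (e : E.Edge) :
      LeavittRel (FreeAlgebra.ι K (.vertex (E.range e)) * FreeAlgebra.ι K (.ghost e))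
        (FreeAlgebra.ι K (.ghost e))
  | ghost_mul_source (e : E.Edge) :
      LeavittRel (FreeAlgebra.ι K (.ghost e) * FreeAlgebra.ι K (.vertex (E.source e)))
        (FreeAlgebra.ι K (.ghost e))
  | ck1_self (e : E.Edge) :
      LeavittRel (FreeAlgebra.ι K (.ghost e) * FreeAlgebra.ι K (.edge e))
        (FreeAlgebra.ι K (.vertex (E.range e)))
  | ck1_ne (e f : E.Edge) (h : e ≠ f) :
      LeavittRel (FreeAlgebra.ι K (.ghost e) * FreeAlgebra.ι K (.edge f)) 0
  | ck2 (x : E.Vertex) (h : ∃ e : E.Edge, E.source e = x) :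
      LeavittRel (∑ e : E.Edge with E.source e = x,
        FreeAlgebra.ι K (.edge e) * FreeAlgebra.ι K (.ghost e)) (FreeAlgebra.ι K (.vertex x))
  | sum_vertex :
      LeavittRel (∑ x : E.Vertex, FreeAlgebra.ι K (.vertex x)) 1

/-- The Leavitt path algebra `L_K(E)` of a finite graph `E`. -/
def LeavittPathAlgebra : Type (max u v) := RingQuot (LeavittRel K E)

namespace LeavittPathAlgebra

noncomputable instance : Ring (LeavittPathAlgebra K E) :=
  inferInstanceAs (Ring (RingQuot (LeavittRel K E)))

noncomputable instance : Algebra K (LeavittPathAlgebra K E) :=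
  inferInstanceAs (Algebra K (RingQuot (LeavittRel K E)))

/-- The quotient map from the free algebra. -/
noncomputable def mk : FreeAlgebra K (Gen E) →ₐ[K] LeavittPathAlgebra K E :=
  RingQuot.mkAlgHom K (LeavittRel K E)

/-- The image of a generator in `L_K(E)`. -/
noncomputable def gen (g : Gen E) : LeavittPathAlgebra K E := mk K E (FreeAlgebra.ι K g)

/-- The component of degree `n` of the usual `ℤ`-grading of `L_K(E)`: the span of the products
of generators whose degrees add up to `n`. -/
noncomputable def gradedPart (n : ℤ) : Submodule K (LeavittPathAlgebra K E) :=
  Submodule.span K {x | ∃ l : List (Gen E), (l.map Gen.degree).sum = n ∧ x = (l.map (gen K E)).prod}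

theorem mk_surjective : Function.Surjective (mk K E) :=
  RingQuot.mkAlgHom_surjective K (LeavittRel K E)

theorem mk_rel {x y : FreeAlgebra K (Gen E)} (h : LeavittRel K E x y) : mk K E x = mk K E y :=
  RingQuot.mkAlgHom_rel K h

theorem gradedMonoid : SetLike.GradedMonoid (gradedPart K E) where
  one_mem := Submodule.subset_span ⟨[], by simp, by simp⟩
  mul_mem := by
    intro i j a b ha hb
    have h := Submodule.mul_mem_mul ha hb
    rw [gradedPart, gradedPart, Submodule.span_mul_span] at h
    refine Submodule.span_mono ?_ h
    rintro _ ⟨_, ⟨l, hl, rfl⟩, _, ⟨l', hl', rfl⟩, rfl⟩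
    exact ⟨l ++ l', by simp [hl, hl'], by simp⟩

/-- The homomorphism that sends a generator `g` of degree `n` to `g tⁿ`. -/
noncomputable def coactionFree :
    FreeAlgebra K (Gen E) →ₐ[K] AddMonoidAlgebra (LeavittPathAlgebra K E) ℤ :=
  FreeAlgebra.lift K fun g => AddMonoidAlgebra.single g.degree (gen K E g)

theorem coactionFree_ι (g : Gen E) :
    coactionFree K E (FreeAlgebra.ι K g) = AddMonoidAlgebra.single g.degree (gen K E g) := by
  simp [coactionFree]

theorem coactionFree_rel {x y : FreeAlgebra K (Gen E)} (h : LeavittRel K E x y) :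
    coactionFree K E x = coactionFree K E y := by
  have h' := mk_rel K E h
  cases h with
  | sum_vertex =>
    simp only [map_sum, map_one, coactionFree_ι, Gen.degree] at h' ⊢
    rw [AddMonoidAlgebra.one_def, ← h']
    exact (map_sum (AddMonoidAlgebra.singleAddHom (0 : ℤ)) _ _).symm
  | ck2 x hx =>
    simp only [map_sum, map_mul, coactionFree_ι, Gen.degree, AddMonoidAlgebra.single_mul_single]
      at h' ⊢
    rw [gen, ← h', add_neg_cancel]
    exact (map_sum (AddMonoidAlgebra.singleAddHom (0 : ℤ)) _ _).symm
  | _ =>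
    simp only [map_mul, map_zero, coactionFree_ι, Gen.degree,
      AddMonoidAlgebra.single_mul_single] at h' ⊢
    simp only [gen, h', AddMonoidAlgebra.single_zero]
    try norm_num

/-- The coaction `L_K(E) → L_K(E)[t, t⁻¹]` belonging to the grading. -/
noncomputable def coaction :
    LeavittPathAlgebra K E →ₐ[K] AddMonoidAlgebra (LeavittPathAlgebra K E) ℤ :=
  RingQuot.liftAlgHom K ⟨coactionFree K E, fun _ _ h => coactionFree_rel K E h⟩

theorem coaction_gen (g : Gen E) :
    coaction K E (gen K E g) = AddMonoidAlgebra.single g.degree (gen K E g) := by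
  rw [← coactionFree_ι]
  exact RingQuot.liftAlgHom_mkAlgHom_apply K _ _ _

theorem coaction_word (l : List (Gen E)) :
    coaction K E (l.map (gen K E)).prod =
      AddMonoidAlgebra.single (l.map Gen.degree).sum (l.map (gen K E)).prod := by
  induction l with
  | nil => exact map_one _
  | cons g l ih =>
    rw [List.map_cons, List.map_cons, List.prod_cons, List.sum_cons, map_mul, ih, coaction_gen,
      AddMonoidAlgebra.single_mul_single]

theorem coaction_of_mem {n : ℤ} {x : LeavittPathAlgebra K E} (hx : x ∈ gradedPart K E n) :
    coaction K E x = AddMonoidAlgebra.single n x := by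
  induction hx using Submodule.span_induction with
  | mem x hx =>
    obtain ⟨l, rfl, rfl⟩ := hx
    exact coaction_word K E l
  | zero => simp
  | add x y _ _ hx hy => rw [map_add, hx, hy, AddMonoidAlgebra.single_add]
  | smul c x _ hx => rw [map_smul, hx, AddMonoidAlgebra.smul_single]

theorem isInternal : DirectSum.IsInternal (gradedPart K E) := by
  refine isInternal_of_proj _ (fun n => AddMonoidHom.mk' (fun x => (coaction K E x).coeff n) ?_) ?_ ?_ ?_
  · intro a b
    rw [map_add]
    rfl
  · intro n x hx
    simp [coaction_of_mem K E hx, -LaurentPolynomial.single_eq_C_mul_T]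
  · intro n m h x hx
    simp [coaction_of_mem K E hx, h, -LaurentPolynomial.single_eq_C_mul_T]
  · intro x
    obtain ⟨y, rfl⟩ := mk_surjective K E x
    have hm := gradedMonoid K E
    induction y using FreeAlgebra.induction with
    | grade0 c =>
      refine AddSubmonoid.subset_closure ⟨0, ?_⟩
      rw [AlgHom.commutes, Algebra.algebraMap_eq_smul_one]
      exact Submodule.smul_mem _ _ hm.one_mem
    | grade1 g =>
      refine AddSubmonoid.subset_closure
        ⟨g.degree, Submodule.subset_span ⟨[g], by simp, ?_⟩⟩
      rw [List.map_singleton, List.prod_singleton]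
      rfl
    | add a b ha hb => rw [map_add]; exact AddSubmonoid.add_mem _ ha hb
    | mul a b ha hb =>
      rw [map_mul]
      generalize mk K E a = a' at ha ⊢
      generalize mk K E b = b' at hb ⊢
      induction ha using AddSubmonoid.closure_induction with
      | zero => rw [zero_mul]; exact AddSubmonoid.zero_mem _
      | add x y _ _ hx hy => rw [add_mul]; exact AddSubmonoid.add_mem _ hx hy
      | mem x hx =>
        obtain ⟨i, hx⟩ := hx
        induction hb using AddSubmonoid.closure_induction with
        | zero => rw [mul_zero]; exact AddSubmonoid.zero_mem _
        | add y z _ _ hy hz => rw [mul_add]; exact AddSubmonoid.add_mem _ hy hz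
        | mem y hy =>
          obtain ⟨j, hy⟩ := hy
          exact AddSubmonoid.subset_closure ⟨i + j, hm.mul_mem hx hy⟩

noncomputable instance gradedRing : GradedRing (gradedPart K E) :=
  { gradedMonoid K E, (isInternal K E).chooseDecomposition with }

end LeavittPathAlgebra

end DirectedGraph

/-! ### Strongly graded rings -/

/-! A homogeneous graded equivalence contains a graded equivalence, so only the forward direction
has content. It rests on strong grading. If `1 ∈ A_γ A_{-γ}` for all `γ`, Dade's theorem says that
`M ↦ M ⊗_{A₀} A` is an equivalence `Mod-A₀ ≌ Gr-A` with inverse `N ↦ N₀`. Given a graded equivalence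
`φ`, keep `φ` itself and let `η M` be the degree-zero part of `φ(M ⊗_{A₀} A)`; the required
isomorphism is then Dade's isomorphism `N₀ ⊗_{B₀} B ≅ N` at `N = φ(M ⊗_{A₀} A)`. This is
`GradedEquivalent.homogeneously`.

It remains that `A = L_K(E)` is strongly graded when `E` is finite without sinks
(`isStronglyGraded`). Degrees `1` and `-1` suffice, since the good degrees are closed under
addition. Summing `v = ∑ e e*` over all vertices gives `1 ∈ A₁ A₋₁`. The inclusion `1 ∈ A₋₁ A₁` is
harder, because a vertex that receives no edge is not some `e* e`. Iterating the same relation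
writes `1` as a sum of terms `p x q` of degrees `n, 0, -n`, with `x` the end of a path of length
`n`. These sets of endpoints decrease with `n` and, `E⁰` being finite, two consecutive ones agree.
For such an `n`, `x` also ends a path `β` of length `n + 1`, so `x = β* β` and `p x q = (p β*)(β q)
∈ A₋₁ A₁`. -/

/-- The additive subgroup `A_γ A_δ` of `A`. -/
def gradedMul {Γ : Type v} {A : Type u} [Ring A] {σ : Type*} [SetLike σ A] (𝒜 : Γ → σ) (γ δ : Γ) :
    AddSubgroup A :=
  AddSubgroup.closure {z | ∃ x ∈ 𝒜 γ, ∃ y ∈ 𝒜 δ, z = x * y}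

theorem mul_mem_gradedMul {Γ : Type v} {A : Type u} [Ring A] {σ : Type*} [SetLike σ A]
    {𝒜 : Γ → σ} {γ δ : Γ} {x y : A} (hx : x ∈ 𝒜 γ) (hy : y ∈ 𝒜 δ) :
    x * y ∈ gradedMul 𝒜 γ δ :=
  AddSubgroup.subset_closure ⟨x, hx, y, hy, rfl⟩

section Strong

variable {Γ : Type v} [AddCommGroup Γ] [DecidableEq Γ]
variable {A : Type u} [Ring A] {σ : Type*} [SetLike σ A] [AddSubgroupClass σ A]

/-- A graded ring is strongly graded when `1 ∈ A_γ A_{-γ}` for each `γ`. -/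
def IsStronglyGraded (𝒜 : Γ → σ) : Prop := ∀ γ : Γ, (1 : A) ∈ gradedMul 𝒜 γ (-γ)

variable {𝒜 : Γ → σ} [GradedRing 𝒜]

/-- The elements `γ` with `1 ∈ A_γ A_{-γ}` are closed under addition. -/
theorem one_mem_gradedMul_add {γ δ : Γ} (hγ : (1 : A) ∈ gradedMul 𝒜 γ (-γ))
    (hδ : (1 : A) ∈ gradedMul 𝒜 δ (-δ)) : (1 : A) ∈ gradedMul 𝒜 (γ + δ) (-(γ + δ)) := by
  have key : ∀ z ∈ gradedMul 𝒜 γ (-γ), z ∈ gradedMul 𝒜 (γ + δ) (-(γ + δ)) := by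
    intro z hz
    induction hz using AddSubgroup.closure_induction with
    | zero => exact zero_mem _
    | add a b _ _ ha hb => exact add_mem ha hb
    | neg a _ ha => exact neg_mem ha
    | mem z hz =>
      obtain ⟨x, hx, y, hy, rfl⟩ := hz
      -- Insert `1 ∈ A_δ A_{-δ}` between the two factors of `x y`.
      suffices h : ∀ t ∈ gradedMul 𝒜 δ (-δ), x * t * y ∈ gradedMul 𝒜 (γ + δ) (-(γ + δ)) by
        simpa using h 1 hδ
      intro t ht
      induction ht using AddSubgroup.closure_induction with
      | zero => simp
      | add a b _ _ ha hb => rw [mul_add, add_mul]; exact add_mem ha hb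
      | neg a _ ha => rw [mul_neg, neg_mul]; exact neg_mem ha
      | mem t ht =>
        obtain ⟨a, ha, b, hb, rfl⟩ := ht
        rw [show x * (a * b) * y = (x * a) * (b * y) by simp only [mul_assoc]]
        refine mul_mem_gradedMul (SetLike.mul_mem_graded hx ha) ?_
        rw [neg_add, add_comm]
        exact SetLike.mul_mem_graded hb hy
  exact key 1 hγ

theorem one_mem_gradedMul_zero : (1 : A) ∈ gradedMul 𝒜 (0 : Γ) (-0) := by
  have h : (1 : A) ∈ 𝒜 0 := SetLike.GradedOne.one_mem
  simpa using mul_mem_gradedMul (𝒜 := 𝒜) (δ := -0) h (by simpa using h)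

theorem one_mem_gradedMul_nsmul {γ : Γ} (hγ : (1 : A) ∈ gradedMul 𝒜 γ (-γ)) (n : ℕ) :
    (1 : A) ∈ gradedMul 𝒜 (n • γ) (-(n • γ)) := by
  induction n with
  | zero => rw [zero_smul]; exact one_mem_gradedMul_zero
  | succ n ih => rw [succ_nsmul]; exact one_mem_gradedMul_add ih hγ

end Strong

/-- A `ℤ`-graded ring with `1 ∈ A₁ A₋₁` and `1 ∈ A₋₁ A₁` is strongly graded. -/
theorem IsStronglyGraded.of_int {A : Type u} [Ring A] {σ : Type*} [SetLike σ A]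
    [AddSubgroupClass σ A] {𝒜 : ℤ → σ} [GradedRing 𝒜]
    (h : (1 : A) ∈ gradedMul 𝒜 1 (-1)) (h' : (1 : A) ∈ gradedMul 𝒜 (-1) 1) :
    IsStronglyGraded 𝒜 := by
  intro n
  obtain ⟨k, rfl | rfl⟩ := n.eq_nat_or_neg
  · simpa using one_mem_gradedMul_nsmul h k
  · simpa using one_mem_gradedMul_nsmul (γ := (-1 : ℤ)) (by simpa using h') k

/-! ### Homomorphisms of graded modules -/

namespace GrMod

variable {Γ : Type v} [AddCommGroup Γ] [DecidableEq Γ]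
variable {A : Type u} [Ring A] {σ : Type*} [SetLike σ A] [AddSubgroupClass σ A]
variable {𝒜 : Γ → σ} [GradedRing 𝒜]

/-- Graded maps commute with the projections onto homogeneous components, so kernels and images can
be tested degree by degree. -/
theorem Hom.decompose_map {M N : GrMod.{u, v, w} 𝒜} [DirectSum.Decomposition M.deg]
    [DirectSum.Decomposition N.deg] (f : Hom M N) (x : M.carrier) (γ : Γ) :
    (DirectSum.decompose N.deg (f.toLinearMap x) γ : N.carrier) =
      f.toLinearMap (DirectSum.decompose M.deg x γ : M.carrier) := by
  induction x using DirectSum.Decomposition.inductionOn M.deg with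
  | zero => simp
  | add a b ha hb => simp [ha, hb]
  | @homogeneous i m =>
    by_cases h : i = γ
    · subst h
      rw [DirectSum.decompose_of_mem_same _ (f.map_mem m.2),
        DirectSum.decompose_of_mem_same _ m.2]
    · rw [DirectSum.decompose_of_mem_ne _ (f.map_mem m.2) h,
        DirectSum.decompose_of_mem_ne _ m.2 h, map_zero]

/-- An injective graded homomorphism reflects degrees. -/
theorem Hom.mem_of_map_mem {M N : GrMod.{u, v, w} 𝒜} (f : Hom M N)
    (hf : Function.Injective f.toLinearMap) {γ : Γ} {x : M.carrier}
    (hx : f.toLinearMap x ∈ N.deg γ) : x ∈ M.deg γ := by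
  let := M.isInternal.chooseDecomposition
  let := N.isInternal.chooseDecomposition
  have h := f.decompose_map x γ
  rw [DirectSum.decompose_of_mem_same _ hx] at h
  -- `f x` equals `f` of the degree-`γ` component of `x`, so injectivity makes `x` that component.
  rw [hf h]
  exact (DirectSum.decompose M.deg x γ).2

theorem Hom.injective_of_homogeneous {M N : GrMod.{u, v, w} 𝒜} (f : Hom M N)
    (hf : ∀ γ, ∀ x ∈ M.deg γ, f.toLinearMap x = 0 → x = 0) :
    Function.Injective f.toLinearMap := by
  let := M.isInternal.chooseDecomposition
  let := N.isInternal.chooseDecomposition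
  rw [injective_iff_map_eq_zero]
  intro x hx
  refine (DirectSum.decompose M.deg).injective ?_
  ext γ
  rw [hf γ _ (DirectSum.decompose M.deg x γ).2 (by rw [← f.decompose_map, hx]; simp)]
  simp

theorem Hom.surjective_of_homogeneous {M N : GrMod.{u, v, w} 𝒜} (f : Hom M N)
    (hf : ∀ γ, ∀ y ∈ N.deg γ, y ∈ LinearMap.range f.toLinearMap) :
    Function.Surjective f.toLinearMap := by
  classical
  let := N.isInternal.chooseDecomposition
  intro y
  change y ∈ LinearMap.range f.toLinearMap
  rw [← DirectSum.sum_support_decompose N.deg y]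
  exact sum_mem fun γ _ => hf γ _ (DirectSum.decompose N.deg y γ).2

/-- A bijective graded homomorphism is an isomorphism in `Gr-A`. -/
theorem isIso_of_bijective {M N : GrMod.{u, v, w} 𝒜} (f : M ⟶ N)
    (hf : Function.Bijective (Hom.toLinearMap f)) : IsIso f := by
  let e := LinearEquiv.ofBijective (Hom.toLinearMap f) hf
  refine ⟨⟨e.symm.toLinearMap, fun γ y hy => ?_⟩, ?_, ?_⟩
  · refine Hom.mem_of_map_mem f hf.1 ?_
    exact (congrArg (· ∈ N.deg γ) (e.apply_symm_apply y)).mpr hy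
  · exact Hom.ext (LinearMap.ext fun x => e.symm_apply_apply x)
  · exact Hom.ext (LinearMap.ext fun x => e.apply_symm_apply x)

/-! ### The degree-zero part -/

theorem smul_mem_zero (M : GrMod.{u, v, w} 𝒜) {γ : Γ} {m : M.carrier} {a : A}
    (hm : m ∈ M.deg γ) (ha : a ∈ 𝒜 (-γ)) : op a • m ∈ M.deg 0 := by
  have := M.smul_mem hm ha
  rwa [add_neg_cancel] at this

instance (M : GrMod.{u, v, w} 𝒜) : Module (𝒜 0)ᵐᵒᵖ (M.deg 0) where
  smul r m := ⟨op (r.unop : A) • (m : M.carrier), by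
    have := M.smul_mem m.2 r.unop.2
    rwa [zero_add] at this⟩
  one_smul m := Subtype.ext (one_smul Aᵐᵒᵖ (m : M.carrier))
  mul_smul r s m := Subtype.ext (mul_smul (op (r.unop : A)) (op (s.unop : A)) (m : M.carrier))
  smul_zero r := Subtype.ext (smul_zero (op (r.unop : A)))
  smul_add r m n := Subtype.ext (smul_add (op (r.unop : A)) (m : M.carrier) n)
  add_smul r s m := Subtype.ext (add_smul (op (r.unop : A)) (op (s.unop : A)) (m : M.carrier))
  zero_smul m := Subtype.ext (zero_smul Aᵐᵒᵖ (m : M.carrier))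

variable (𝒜) in
/-- The functor `Gr-A ⥤ Mod-A₀`, `M ↦ M₀`. -/
def zeroPart : GrMod.{u, v, w} 𝒜 ⥤ ModuleCat.{w} (𝒜 0)ᵐᵒᵖ where
  obj M := ModuleCat.of _ (M.deg 0)
  map {M N} f := ModuleCat.ofHom
    { toFun := fun m => ⟨Hom.toLinearMap f m, Hom.map_mem f m.2⟩
      map_add' := fun m n => Subtype.ext (map_add (Hom.toLinearMap f) (m : M.carrier) n)
      map_smul' := fun r m =>
        Subtype.ext ((Hom.toLinearMap f).map_smul (op (r.unop : A)) (m : M.carrier)) }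

end GrMod

/-! ### Induction as a functor, and Dade's theorem -/

namespace InducedGr

variable {Γ : Type v} [AddCommGroup Γ] [DecidableEq Γ]
variable {A : Type u} [Ring A] {σ : Type*} [SetLike σ A] [AddSubgroupClass σ A]
variable (𝒜 : Γ → σ) [GradedRing 𝒜]

section

variable (M : Type w) [AddCommGroup M] [Module (𝒜 0)ᵐᵒᵖ M]

theorem add_tmul (m n : M) (a : A) : tmul 𝒜 M (m + n) a = tmul 𝒜 M m a + tmul 𝒜 M n a := by
  rw [tmul, TensorProduct.tmul_add, map_add]; rfl

theorem op_smul_tmul (m : M) (r : 𝒜 0) (a : A) :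
    tmul 𝒜 M (op r • m) a = tmul 𝒜 M m ((r : A) * a) := by
  symm
  rw [← sub_eq_zero, tmul, tmul, ← map_sub]
  exact (Submodule.Quotient.mk_eq_zero _).2 (Submodule.subset_span ⟨a, r, m, rfl⟩)

/-- The universal property of `M ⊗_{A₀} A`, for additive maps. -/
noncomputable def liftAdd {N : Type z} [AddCommGroup N] (f : M →+ A →+ N)
    (hf : ∀ m (r : 𝒜 0) a, f (op r • m) a = f m ((r : A) * a)) : Carrier 𝒜 M →+ N :=
  QuotientAddGroup.lift (relations 𝒜 M).toAddSubgroup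
    -- The flip matches the order of factors in `A ⊗_ℤ M`; balancing over `ℤ` is automatic for
    -- biadditive maps.
    (TensorProduct.liftAddHom f.flip fun n a m => by
      change f m (n • a) = f (n • m) a
      rw [map_zsmul, map_zsmul]
      rfl) (by
      intro x hx
      change x ∈ relations 𝒜 M at hx
      induction hx using Submodule.closure_induction with
      | zero => exact map_zero _
      | add x y _ _ hx hy => exact (map_add _ x y).trans (by rw [hx, hy, add_zero])
      -- Multiplying a relation by `b` only replaces `a` by `a b`, so `hf` still applies.
      | smul_mem b x hx =>
        obtain ⟨a, r, m, rfl⟩ := hx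
        rw [smul_sub, TensorProduct.smul_tmul', TensorProduct.smul_tmul']
        refine (map_sub _ _ _).trans (sub_eq_zero.2 ?_)
        change f m ((r : A) * a * b.unop) = f (op r • m) (a * b.unop)
        rw [hf, mul_assoc])

/-- The universal property of `M ⊗_{A₀} A`, for `A`-linear maps. -/
noncomputable def lift {N : Type z} [AddCommGroup N] [Module Aᵐᵒᵖ N] (g : M →+ N)
    (hg : ∀ m (r : 𝒜 0), g (op r • m) = op (r : A) • g m) : Carrier 𝒜 M →ₗ[Aᵐᵒᵖ] N :=
  let f : M →+ A →+ N := AddMonoidHom.mk'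
    (fun m => AddMonoidHom.mk' (fun a => op a • g m) fun a b => by rw [MulOpposite.op_add, add_smul])
    fun m n => by ext a; simp
  let F := liftAdd 𝒜 M f fun m r a => by
    change op a • g (op r • m) = op ((r : A) * a) • g m
    rw [hg, op_mul, mul_smul]
  { toFun := F
    map_add' := map_add F
    map_smul' := fun b x => by
      change F (b • x) = b • F x
      induction x using tmul_induction with
      | h0 => rw [smul_zero, map_zero, smul_zero]
      | ha x y hx hy => rw [smul_add, map_add, map_add, smul_add, hx, hy]
      | ht m a =>
        change op (a * b.unop) • g m = b • op a • g m
        rw [op_mul, mul_smul, op_unop] }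

theorem lift_mem {N : Type z} [AddCommGroup N] [Module Aᵐᵒᵖ N] (g : M →+ N)
    (hg : ∀ m (r : 𝒜 0), g (op r • m) = op (r : A) • g m) {γ : Γ} (S : AddSubgroup N)
    (hS : ∀ m, ∀ a ∈ 𝒜 γ, op a • g m ∈ S) {x : Carrier 𝒜 M} (hx : x ∈ deg 𝒜 M γ) :
    lift 𝒜 M g hg x ∈ S := by
  induction hx using AddSubgroup.closure_induction with
  | zero => rw [map_zero]; exact zero_mem _
  | add x y _ _ hx hy => rw [map_add]; exact add_mem hx hy
  | neg x _ hx => rw [map_neg]; exact neg_mem hx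
  | mem x hx =>
    obtain ⟨m, a, ha, rfl⟩ := hx
    exact hS m a ha

-- The elements `m ⊗ 1` generate, because `m ⊗ a = (m ⊗ 1) a`.
variable {𝒜 M} in
theorem linearMap_ext {N : Type z} [AddCommGroup N] [Module Aᵐᵒᵖ N]
    {f g : Carrier 𝒜 M →ₗ[Aᵐᵒᵖ] N} (h : ∀ m, f (tmul 𝒜 M m 1) = g (tmul 𝒜 M m 1)) : f = g := by
  refine LinearMap.ext fun x => ?_
  induction x using tmul_induction with
  | h0 => simp
  | ha x y hx hy => simp [hx, hy]
  | ht m a => rw [← one_mul a, ← smul_tmul, map_smul, map_smul, h]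

theorem tmul_mem {γ : Γ} (m : M) {a : A} (ha : a ∈ 𝒜 γ) : tmul 𝒜 M m a ∈ deg 𝒜 M γ :=
  AddSubgroup.subset_closure ⟨m, a, ha, rfl⟩

theorem tmul_one_mem (m : M) : tmul 𝒜 M m 1 ∈ deg 𝒜 M 0 :=
  tmul_mem 𝒜 M m SetLike.GradedOne.one_mem

/-- For `a ∈ A₀` the tensor relation gives `m ⊗ a = m a ⊗ 1`. -/
theorem eq_tmul_one_of_mem {x : Carrier 𝒜 M} (hx : x ∈ deg 𝒜 M 0) :
    ∃ m, x = tmul 𝒜 M m 1 := by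
  induction hx using AddSubgroup.closure_induction with
  | zero => exact ⟨0, by rw [tmul, TensorProduct.tmul_zero, map_zero]⟩
  | add x y _ _ hx hy =>
    obtain ⟨m, rfl⟩ := hx
    obtain ⟨n, rfl⟩ := hy
    exact ⟨m + n, (add_tmul 𝒜 M m n 1).symm⟩
  | neg x _ hx =>
    obtain ⟨m, rfl⟩ := hx
    exact ⟨-m, by rw [tmul, tmul, TensorProduct.tmul_neg, map_neg]⟩
  | mem x hx =>
    obtain ⟨m, a, ha, rfl⟩ := hx
    exact ⟨op (⟨a, ha⟩ : 𝒜 0) • m, by rw [op_smul_tmul, mul_one]⟩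

theorem coe_proj_zero_mul (r : 𝒜 0) (a : A) :
    DirectSum.decompose 𝒜 ((r : A) * a) 0 = r * DirectSum.decompose 𝒜 a 0 :=
  Subtype.ext (proj_zero_mul 𝒜 0 r a)

/-- The map `M ⊗_{A₀} A → M`, `m ⊗ a ↦ m a₀`. -/
noncomputable def retract : Carrier 𝒜 M →+ M :=
  liftAdd 𝒜 M
    (AddMonoidHom.mk' (fun m => AddMonoidHom.mk' (fun a => op (DirectSum.decompose 𝒜 a 0) • m)
      fun a b => by simp [add_smul]) fun m n => by ext a; simp)
    fun m r a => by
      change op (DirectSum.decompose 𝒜 a 0) • op r • m =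
        op (DirectSum.decompose 𝒜 ((r : A) * a) 0) • m
      rw [coe_proj_zero_mul, op_mul, mul_smul]

/-- This left inverse makes `m ↦ m ⊗ 1` injective, so `M ≅ (M ⊗_{A₀} A)₀` needs no strong grading.
-/
theorem retract_tmul_one (m : M) : retract 𝒜 M (tmul 𝒜 M m 1) = m := by
  change op (DirectSum.decompose 𝒜 (1 : A) 0) • m = m
  have h : DirectSum.decompose 𝒜 (1 : A) 0 = 1 :=
    Subtype.ext (DirectSum.decompose_of_mem_same 𝒜 SetLike.GradedOne.one_mem)
  rw [h, op_one, one_smul]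

end

/-- The graded homomorphism `f ⊗ id : M ⊗_{A₀} A → N ⊗_{A₀} A`. -/
noncomputable def map {M N : ModuleCat.{max u w} (𝒜 0)ᵐᵒᵖ} (f : M ⟶ N) :
    inducedGr.{u, v, w} 𝒜 M ⟶ inducedGr.{u, v, w} 𝒜 N where
  toLinearMap := lift 𝒜 M
    (AddMonoidHom.mk' (fun m => tmul 𝒜 N (f.hom m) 1) fun m n => by
      rw [map_add]
      exact add_tmul 𝒜 N _ _ 1)
    fun m r => by
      change tmul 𝒜 N (f.hom (op r • m)) 1 = op (r : A) • tmul 𝒜 N (f.hom m) 1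
      rw [map_smul, op_smul_tmul, smul_tmul, mul_one, one_mul]
  map_mem := fun γ x hx => lift_mem 𝒜 M _ _ (deg 𝒜 N γ) (fun m a ha => by
    change op a • tmul 𝒜 N (f.hom m) 1 ∈ deg 𝒜 N γ
    rw [smul_tmul, one_mul]
    exact tmul_mem 𝒜 N _ ha) hx

theorem map_tmul_one {M N : ModuleCat.{max u w} (𝒜 0)ᵐᵒᵖ} (f : M ⟶ N) (m : M) :
    GrMod.Hom.toLinearMap (map.{u, v, w} 𝒜 f) (tmul 𝒜 M m 1) = tmul 𝒜 N (f.hom m) 1 :=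
  one_smul Aᵐᵒᵖ (tmul 𝒜 N (f.hom m) 1)

/-- Induction `M ↦ M ⊗_{A₀} A` as a functor `Mod-A₀ ⥤ Gr-A`. -/
noncomputable def functor :
    ModuleCat.{max u w} (𝒜 0)ᵐᵒᵖ ⥤ GrMod.{u, v, max u w} 𝒜 where
  obj M := inducedGr.{u, v, w} 𝒜 M
  map f := map.{u, v, w} 𝒜 f
  map_id M := GrMod.Hom.ext <| linearMap_ext fun m => map_tmul_one.{u, v, w} 𝒜 (𝟙 M) m
  map_comp {M N P} f g := GrMod.Hom.ext <| linearMap_ext fun m => by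
    refine (map_tmul_one.{u, v, w} 𝒜 (f ≫ g) m).trans ?_
    refine (map_tmul_one.{u, v, w} 𝒜 g (f.hom m)).symm.trans ?_
    exact congrArg (GrMod.Hom.toLinearMap (map.{u, v, w} 𝒜 g))
      (map_tmul_one.{u, v, w} 𝒜 f m).symm

/-- The isomorphism `M ≅ (M ⊗_{A₀} A)₀`. -/
noncomputable def unitIso :
    𝟭 (ModuleCat.{max u w} (𝒜 0)ᵐᵒᵖ) ≅ functor.{u, v, w} 𝒜 ⋙ GrMod.zeroPart 𝒜 :=
  NatIso.ofComponents
    (fun M => LinearEquiv.toModuleIso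
      (LinearEquiv.ofBijective
        ({ toFun := fun m => ⟨tmul 𝒜 M m 1, tmul_one_mem 𝒜 M m⟩
           map_add' := fun m n => Subtype.ext (add_tmul 𝒜 M m n 1)
           map_smul' := fun r m => Subtype.ext (by
            refine (op_smul_tmul 𝒜 M m r.unop 1).trans ?_
            change _ = op (r.unop : A) • tmul 𝒜 M m 1
            rw [smul_tmul, mul_one, one_mul]) } :
          M →ₗ[(𝒜 0)ᵐᵒᵖ] (inducedGr.{u, v, w} 𝒜 M).deg 0)
        ⟨fun m n h => by
          rw [← retract_tmul_one 𝒜 M m, ← retract_tmul_one 𝒜 M n]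
          exact congrArg (fun t => retract 𝒜 M t.1) h,
        fun x => by
          obtain ⟨m, hm⟩ := eq_tmul_one_of_mem 𝒜 M x.2
          exact ⟨m, Subtype.ext hm.symm⟩⟩))
    fun {M N} f => by
      ext m
      exact Subtype.ext (map_tmul_one 𝒜 f m).symm

/-- The map `N₀ ⊗_{A₀} A → N`, `n ⊗ a ↦ n a`. -/
noncomputable def counit (N : GrMod.{u, v, max u w} 𝒜) :
    (functor.{u, v, w} 𝒜).obj ((GrMod.zeroPart 𝒜).obj N) ⟶ N where
  toLinearMap := lift 𝒜 (N.deg 0) (N.deg 0).subtype fun _ _ => rfl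
  map_mem := fun γ x hx => lift_mem 𝒜 (N.deg 0) _ _ (N.deg γ) (fun m a ha => by
    have := N.smul_mem m.2 ha
    rwa [zero_add] at this) hx

theorem counit_tmul (N : GrMod.{u, v, max u w} 𝒜) (n : N.deg 0) (a : A) :
    GrMod.Hom.toLinearMap (counit.{u, v, w} 𝒜 N) (tmul 𝒜 (N.deg 0) n a) =
      op a • (n : N.carrier) := rfl

-- In degree zero the kernel vanishes, since `n ⊗ 1 ↦ n`. A kernel element `x` of degree `γ` is
-- moved there: `x a` is zero for every `a ∈ A_{-γ}`, hence `x = x · 1` is zero because `1 ∈ A_{-γ}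
-- A_γ`.
variable {𝒜} in
theorem counit_injective (h𝒜 : IsStronglyGraded 𝒜) (N : GrMod.{u, v, max u w} 𝒜) :
    Function.Injective (GrMod.Hom.toLinearMap (counit.{u, v, w} 𝒜 N)) := by
  refine GrMod.Hom.injective_of_homogeneous _ fun γ x hx h0 => ?_
  suffices h : ∀ t ∈ gradedMul 𝒜 (-γ) (-(-γ)), op t • x = 0 by
    simpa using h 1 (h𝒜 (-γ))
  intro t ht
  induction ht using AddSubgroup.closure_induction with
  | zero => rw [op_zero, zero_smul]
  | add a b _ _ ha hb => rw [MulOpposite.op_add, add_smul, ha, hb, add_zero]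
  | neg a _ ha => rw [MulOpposite.op_neg, neg_smul, ha, neg_zero]
  | mem t ht =>
    obtain ⟨a, ha, b, hb, rfl⟩ := ht
    have hmem := GrMod.smul_mem_zero _ hx ha
    obtain ⟨n, hn⟩ : ∃ n : N.deg 0, op a • x = tmul 𝒜 (N.deg 0) n 1 :=
      eq_tmul_one_of_mem 𝒜 ((GrMod.zeroPart 𝒜).obj N) hmem
    have h1 : (n : N.carrier) = 0 := by
      -- `n` is the image of `n ⊗ 1 = x a`, hence equals the image of `x` times `a`, which is zero.
      rw [← one_smul Aᵐᵒᵖ (n : N.carrier), ← op_one, ← counit_tmul]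
      refine (congrArg (GrMod.Hom.toLinearMap (counit.{u, v, w} 𝒜 N)) hn).symm.trans ?_
      rw [map_smul, h0, smul_zero]
    have h2 : n = 0 := Subtype.ext h1
    have h3 : op a • x = 0 := by
      refine hn.trans ?_
      rw [h2, tmul, TensorProduct.tmul_zero, map_zero]
      rfl
    rw [op_mul, mul_smul, h3, smul_zero]

-- For `y` of degree `γ`, write `1 = ∑ a b` with `a ∈ A_{-γ}` and `b ∈ A_γ`; then `y = ∑ (y a) b` is
-- the image of `∑ (y a) ⊗ b`, with `y a ∈ N₀`.
variable {𝒜} in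
theorem counit_surjective (h𝒜 : IsStronglyGraded 𝒜) (N : GrMod.{u, v, max u w} 𝒜) :
    Function.Surjective (GrMod.Hom.toLinearMap (counit.{u, v, w} 𝒜 N)) := by
  refine GrMod.Hom.surjective_of_homogeneous _ fun γ y hy => ?_
  suffices h : ∀ t ∈ gradedMul 𝒜 (-γ) (-(-γ)),
      op t • y ∈ LinearMap.range (GrMod.Hom.toLinearMap (counit.{u, v, w} 𝒜 N)) by
    simpa using h 1 (h𝒜 (-γ))
  intro t ht
  induction ht using AddSubgroup.closure_induction with
  | zero => rw [op_zero, zero_smul]; exact zero_mem _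
  | add a b _ _ ha hb => rw [MulOpposite.op_add, add_smul]; exact add_mem ha hb
  | neg a _ ha => rw [MulOpposite.op_neg, neg_smul]; exact neg_mem ha
  | mem t ht =>
    obtain ⟨a, ha, b, hb, rfl⟩ := ht
    refine ⟨tmul 𝒜 (N.deg 0) ⟨op a • y, N.smul_mem_zero hy ha⟩ b, ?_⟩
    rw [counit_tmul, op_mul, mul_smul]

variable {𝒜} in
theorem isIso_counit (h𝒜 : IsStronglyGraded 𝒜) (N : GrMod.{u, v, max u w} 𝒜) :
    IsIso (counit.{u, v, w} 𝒜 N) :=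
  GrMod.isIso_of_bijective _ ⟨counit_injective h𝒜 N, counit_surjective h𝒜 N⟩

variable {𝒜} in
/-- The isomorphism `N₀ ⊗_{A₀} A ≅ N` over a strongly graded ring. -/
noncomputable def counitIso (h𝒜 : IsStronglyGraded 𝒜) :
    GrMod.zeroPart 𝒜 ⋙ functor.{u, v, w} 𝒜 ≅ 𝟭 (GrMod.{u, v, max u w} 𝒜) :=
  NatIso.ofComponents
    (fun N => haveI := isIso_counit h𝒜 N; asIso (counit.{u, v, w} 𝒜 N))
    fun {M N} f => GrMod.Hom.ext <| linearMap_ext fun m => by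
      refine (congrArg (GrMod.Hom.toLinearMap (counit.{u, v, w} 𝒜 N))
        (map_tmul_one.{u, v, w} 𝒜 ((GrMod.zeroPart 𝒜).map f) m)).trans ?_
      exact ((GrMod.Hom.toLinearMap f).map_smul (op (1 : A)) (m : M.deg 0).1).symm

variable {𝒜} in
/-- Dade's theorem: over a strongly graded ring, induction is an equivalence
`Mod-A₀ ≌ Gr-A`. -/
noncomputable def equivalence (h𝒜 : IsStronglyGraded 𝒜) :
    ModuleCat.{max u w} (𝒜 0)ᵐᵒᵖ ≌ GrMod.{u, v, max u w} 𝒜 :=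
  CategoryTheory.Equivalence.mk (functor.{u, v, w} 𝒜) (GrMod.zeroPart 𝒜) (unitIso.{u, v, w} 𝒜)
    (counitIso.{u, v, w} h𝒜)

end InducedGr

/-- Graded equivalent strongly graded rings are homogeneously graded equivalent. -/
theorem GradedEquivalent.homogeneously {Γ : Type v} [AddCommGroup Γ] [DecidableEq Γ]
    {A B : Type u} [Ring A] [Ring B] {σ τ : Type*} [SetLike σ A] [AddSubgroupClass σ A]
    [SetLike τ B] [AddSubgroupClass τ B] {𝒜 : Γ → σ} [GradedRing 𝒜] {ℬ : Γ → τ} [GradedRing ℬ]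
    (h𝒜 : IsStronglyGraded 𝒜) (hℬ : IsStronglyGraded ℬ)
    (h : GradedEquivalent.{u, v, w} 𝒜 ℬ) : HomogeneouslyGradedEquivalent.{u, v, w} 𝒜 ℬ := by
  obtain ⟨φ, hφ⟩ := h
  refine ⟨φ, hφ, ?_⟩
  obtain ⟨-, ψ, -, ⟨i⟩, ⟨j⟩⟩ := hφ
  let e : GrMod.{u, v, max u w} 𝒜 ≌ GrMod.{u, v, max u w} ℬ :=
    CategoryTheory.Equivalence.mk φ ψ i.symm j
  -- `η` is the composite `Mod-A₀ ≌ Gr-A ≌ Gr-B ≌ Mod-B₀`.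
  refine ⟨_, (((InducedGr.equivalence.{u, v, w} h𝒜).trans e).trans
    (InducedGr.equivalence.{u, v, w} hℬ).symm).isEquivalence_functor, fun M => ?_⟩
  exact ⟨((InducedGr.counitIso.{u, v, w} hℬ).app
    (φ.obj (inducedGr.{u, v, w} 𝒜 M))).symm⟩

/-! ### Leavitt path algebras of finite graphs without sinks are strongly graded -/

namespace DirectedGraph

/-- The vertices that are the range of a path of length `n`. -/
def endpoints (E : DirectedGraph.{v}) : ℕ → Set E.Vertex
  | 0 => Set.univ
  | n + 1 => E.range '' (E.source ⁻¹' E.endpoints n)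

/-- Dropping the first edge of a path keeps its endpoint. -/
theorem endpoints_succ_subset (E : DirectedGraph.{v}) (n : ℕ) :
    E.endpoints (n + 1) ⊆ E.endpoints n := by
  induction n with
  | zero => exact Set.subset_univ _
  | succ n ih => exact Set.image_mono (Set.preimage_mono ih)

theorem exists_endpoints_succ_eq (E : DirectedGraph.{v}) [Finite E.Vertex] :
    ∃ n, E.endpoints n = E.endpoints (n + 1) := by
  -- The order dual turns the descending chain of subsets into an ascending one.
  obtain ⟨n, hn⟩ := WellFoundedGT.monotone_chain_condition
    (⟨fun n => OrderDual.toDual (E.endpoints n),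
      monotone_nat_of_le_succ E.endpoints_succ_subset⟩ : ℕ →o (Set E.Vertex)ᵒᵈ)
  exact ⟨n, hn (n + 1) n.le_succ⟩

namespace LeavittPathAlgebra

variable (K : Type u) [Field K] (E : DirectedGraph.{v}) [Fintype E.Vertex] [Fintype E.Edge]

theorem gen_mem (g : Gen E) : gen K E g ∈ gradedPart K E g.degree :=
  Submodule.subset_span ⟨[g], by simp, by simp⟩

theorem edge_mem (e : E.Edge) : gen K E (.edge e) ∈ gradedPart K E 1 := gen_mem K E (.edge e)

theorem ghost_mem (e : E.Edge) : gen K E (.ghost e) ∈ gradedPart K E (-1) :=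
  gen_mem K E (.ghost e)

variable {K E} in
theorem mul_mem_gradedPart {i j k : ℤ} (h : i + j = k) {a b : LeavittPathAlgebra K E}
    (ha : a ∈ gradedPart K E i) (hb : b ∈ gradedPart K E j) : a * b ∈ gradedPart K E k :=
  h ▸ (gradedMonoid K E).mul_mem ha hb

theorem sum_gen_vertex : ∑ x : E.Vertex, gen K E (.vertex x) = 1 := by
  have := mk_rel K E LeavittRel.sum_vertex
  rwa [map_sum, map_one] at this

open Classical in
theorem sum_edge_mul_ghost (x : E.Vertex) (h : ∃ e : E.Edge, E.source e = x) :
    ∑ e : E.Edge with E.source e = x, gen K E (.edge e) * gen K E (.ghost e) =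
      gen K E (.vertex x) := by
  have := mk_rel K E (LeavittRel.ck2 x h)
  rw [map_sum] at this
  simpa only [map_mul, gen] using this

theorem ghost_mul_edge (e : E.Edge) :
    gen K E (.ghost e) * gen K E (.edge e) = gen K E (.vertex (E.range e)) := by
  have := mk_rel K E (LeavittRel.ck1_self e)
  rwa [map_mul] at this

theorem edge_mul_vertex (e : E.Edge) :
    gen K E (.edge e) * gen K E (.vertex (E.range e)) = gen K E (.edge e) := by
  have := mk_rel K E (LeavittRel.edge_mul_range e)
  rwa [map_mul] at this

theorem ghost_mul_vertex (e : E.Edge) :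
    gen K E (.ghost e) * gen K E (.vertex (E.source e)) = gen K E (.ghost e) := by
  have := mk_rel K E (LeavittRel.ghost_mul_source e)
  rwa [map_mul] at this

/-- The range `x` of a path of length `n` factors as `x = a b` with `a` of degree `-n` and `b` of
degree `n`. -/
theorem exists_mul_eq_vertex {n : ℕ} {x : E.Vertex} (hx : x ∈ E.endpoints n) :
    ∃ a ∈ gradedPart K E (-n), ∃ b ∈ gradedPart K E n, a * b = gen K E (.vertex x) := by
  induction n generalizing x with
  | zero =>
    refine ⟨1, ?_, _, gen_mem K E (.vertex x), one_mul _⟩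
    simpa using (gradedMonoid K E).one_mem
  | succ n ih =>
    obtain ⟨e, he, rfl⟩ := hx
    obtain ⟨a, ha, b, hb, hab⟩ := ih he
    refine ⟨gen K E (.ghost e) * a, mul_mem_gradedPart (by push_cast; ring) (ghost_mem K E e) ha,
      b * gen K E (.edge e), mul_mem_gradedPart (by push_cast; ring) hb (edge_mem K E e), ?_⟩
    -- `e* (a b) e = e* s(e) e = e* e = r(e)`.
    rw [mul_assoc, ← mul_assoc a, hab, ← mul_assoc, ghost_mul_vertex, ghost_mul_edge]

variable {E}

/-- `1` is a sum of products `p x q`, with `p` of degree `n`, `q` of degree `-n`, and `x` the range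
of a path of length `n`. -/
theorem one_mem_closure_endpoints (hE : E.NoSinks) (n : ℕ) :
    (1 : LeavittPathAlgebra K E) ∈ AddSubgroup.closure
      {z | ∃ p ∈ gradedPart K E n, ∃ x ∈ E.endpoints n, ∃ q ∈ gradedPart K E (-n),
        z = p * gen K E (.vertex x) * q} := by
  classical
  have hm := gradedMonoid K E
  induction n with
  | zero =>
    rw [← sum_gen_vertex K E]
    refine sum_mem fun x _ => AddSubgroup.subset_closure
      ⟨1, hm.one_mem, x, Set.mem_univ x, 1, ?_, by simp⟩
    simpa using hm.one_mem
  | succ n ih =>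
    refine (AddSubgroup.closure_le _).2 ?_ ih
    rintro _ ⟨p, hp, x, hx, q, hq, rfl⟩
    -- As `x` is not a sink, it becomes `∑ e e*`; then `e = e r(e)` puts the new endpoint `r(e)` in
    -- the middle.
    rw [← sum_edge_mul_ghost K E x (hE x), Finset.mul_sum, Finset.sum_mul]
    refine sum_mem fun e he => AddSubgroup.subset_closure
      ⟨p * gen K E (.edge e), mul_mem_gradedPart (by push_cast; ring) hp (edge_mem K E e),
        E.range e, ⟨e, ?_, rfl⟩, gen K E (.ghost e) * q,
        mul_mem_gradedPart (by push_cast; ring) (ghost_mem K E e) hq, ?_⟩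
    · rw [Set.mem_preimage, (Finset.mem_filter.1 he).2]
      exact hx
    · rw [mul_assoc p (gen K E (.edge e)), edge_mul_vertex]
      simp only [mul_assoc]

/-- The Leavitt path algebra of a finite graph without sinks is strongly graded. -/
theorem isStronglyGraded (hE : E.NoSinks) : IsStronglyGraded (gradedPart K E) := by
  classical
  refine IsStronglyGraded.of_int ?_ ?_
  · rw [← sum_gen_vertex K E]
    refine sum_mem fun x _ => ?_
    rw [← sum_edge_mul_ghost K E x (hE x)]
    exact sum_mem fun e _ => mul_mem_gradedMul (edge_mem K E e) (ghost_mem K E e)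
  · obtain ⟨n, hn⟩ := E.exists_endpoints_succ_eq
    refine (AddSubgroup.closure_le _).2 ?_ (one_mem_closure_endpoints K hE n)
    rintro _ ⟨p, hp, x, hx, q, hq, rfl⟩
    -- Stabilization lengthens the path ending at `x` by one: `a` and `b` get degrees `-(n + 1)` and
    -- `n + 1`, so `p a` has degree `-1` and `b q` degree `1`.
    rw [hn] at hx
    obtain ⟨a, ha, b, hb, hab⟩ := exists_mul_eq_vertex K E hx
    rw [← hab, show p * (a * b) * q = (p * a) * (b * q) by simp only [mul_assoc]]
    exact mul_mem_gradedMul (mul_mem_gradedPart (by push_cast; ring) hp ha)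
      (mul_mem_gradedPart (by push_cast; ring) hb hq)

end LeavittPathAlgebra

end DirectedGraph

/-- For finite graphs `E` and `F` without sinks, `L_K(E)` and `L_K(F)`, with their usual
`ℤ`-gradings, are graded equivalent if and only if they are homogeneously graded equivalent. -/
theorem mainTheorem11 (K : Type u) [Field K] (E F : DirectedGraph.{v})
    [Fintype E.Vertex] [Fintype E.Edge] [Fintype F.Vertex] [Fintype F.Edge]
    (hE : E.NoSinks) (hF : F.NoSinks) :
    GradedEquivalent.{max u v, 0, w} (DirectedGraph.LeavittPathAlgebra.gradedPart K E)
        (DirectedGraph.LeavittPathAlgebra.gradedPart K F) ↔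
      HomogeneouslyGradedEquivalent.{max u v, 0, w}
        (DirectedGraph.LeavittPathAlgebra.gradedPart K E)
        (DirectedGraph.LeavittPathAlgebra.gradedPart K F) :=
  ⟨GradedEquivalent.homogeneously (DirectedGraph.LeavittPathAlgebra.isStronglyGraded K hE)
    (DirectedGraph.LeavittPathAlgebra.isStronglyGraded K hF), fun ⟨ψ, hψ, _⟩ => ⟨ψ, hψ⟩⟩
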